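/- **Lemma (Association probability of the V2V link).** Let $\lambda_R,\mu_v,\lambda_b,B,\alpha_v,\alpha_b>0$. The roads are the lines of a motion-invariant Poisson line process, i.e. the lines $\{x\in\mathbb R^2: x_1\cos\theta+x_2\sin\theta=y\}$ for $(\theta,y)$ in a Poisson point process on $[0,\pi)\times\mathbb R$ with intensity $\lambda_R\,d\theta\,dy$, together with one additional (typical) road through the origin. Given the roads, the vehicles form independent homogeneous one-dimensional Poisson point processes of intensity $\mu_v$ on the roads. The base stations form a homogeneous Poisson point process of intensity $\lambda_b$ in $\mathbb R^2$. Let $T$ be the (possibly random) location from which the distance to the base stations is measured (for example the origin, or the location of the vehicle nearest to the origin), and suppose that the base stations are independent of the roads, the vehicles and $T$ jointly. Let $R_v$ be the distance from the origin to the nearest vehicle and $R_b$ the distance from $T$ to the nearest base station. Let $I_n(z)=\sum_{k\ge0}\frac{(z/2)^{2k+n}}{k!\,\Gamma(k+n+1)}$ be the modified Bessel functions of the first kind and $L_n(z)=\sum_{k\ge0}\frac{(z/2)^{2k+n+1}}{\Gamma(k+3/2)\,\Gamma(k+n+3/2)}$ the modified Struve functions. Then $R_v$ has on $(0,\infty)$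 the (nonnegative) probability density $$f_{R_v}(r)=-\exp\!\Big(-2\pi\lambda_R r+\pi^2\lambda_R r\big[L_{-1}(2r\mu_v)-I_1(2r\mu_v)\big]-2r\mu_v\Big)\Big(-2\pi^2\lambda_R r\mu_v\big[I_0(2r\mu_v)-L_0(2r\mu_v)\big]-2\mu_v\Big),$$ and the probability of selecting the V2V link is $$\Pr\big[B R_v^{-\alpha_v}\ge R_b^{-\alpha_b}\big]=\int_0^\infty f_{R_v}(r)\,\exp\!\left(-\pi\lambda_b\left(\frac{r^{\alpha_v/\alpha_b}}{B^{1/\alpha_b}}\right)^{2}\right)dr ,$$ where the integral converges absolutely. -/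

import Mathlib

open MeasureTheory ProbabilityTheory Set

/-- The Euclidean plane. -/
abbrev Plane : Type := EuclideanSpace ℝ (Fin 2)

/-! ### Modified Bessel and Struve functions of integer order -/

/-- Modified Bessel function of the first kind,
`I_n(z) = ∑ₖ (z/2)^(2k+n) / (k! Γ(k+n+1))`. -/
noncomputable def besselI (n : ℤ) (z : ℝ) : ℝ :=
  ∑' k : ℕ, (z / 2) ^ (2 * (k : ℤ) + n) / ((k.factorial : ℝ) * Real.Gamma ((k : ℝ) + n + 1))

/-- Modified Struve function,
`L_n(z) = ∑ₖ (z/2)^(2k+n+1) / (Γ(k+3/2) Γ(k+n+3/2))`. -/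
noncomputable def struveL (n : ℤ) (z : ℝ) : ℝ :=
  ∑' k : ℕ, (z / 2) ^ (2 * (k : ℤ) + n + 1) /
    (Real.Gamma ((k : ℝ) + 3 / 2) * Real.Gamma ((k : ℝ) + n + 3 / 2))

/-! ### Point processes, as random sets of points -/

section PointProcess

variable {Ω X : Type*} [MeasurableSpace Ω] [MeasurableSpace X]

/-- The number (possibly infinite) of points of the random set `Φ` in `A`. -/
noncomputable def pointCount (Φ : Ω → Set X) (A : Set X) (ω : Ω) : ℕ∞ := (Φ ω ∩ A).encard

/-- The σ-algebra on `Ω` generated by a point process, that is, by the numbers of its points in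
measurable sets. -/
@[reducible] noncomputable def pointSigma (Φ : Ω → Set X) : MeasurableSpace Ω :=
  ⨆ A : {A : Set X // MeasurableSet A}, MeasurableSpace.comap (pointCount Φ A) ⊤

/-- `Φ` is a (simple) Poisson point process with intensity measure `ν`: the number of points in a
measurable set of finite intensity is a Poisson variable with parameter its intensity, and the
numbers of points in disjoint measurable sets are independent. -/
structure IsPoissonProcess (P : Measure Ω) (Φ : Ω → Set X) (ν : Measure X) : Prop where
  measurable_count : ∀ A, MeasurableSet A → Measurable (pointCount Φ A)
  law_count : ∀ A, MeasurableSet A → ν A ≠ ⊤ →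
    P.map (pointCount Φ A) = (poissonMeasure (ν A).toNNReal).map (fun k : ℕ => (k : ℕ∞))
  indep_count : ∀ (m : ℕ) (A : Fin m → Set X), (∀ i, MeasurableSet (A i)) →
    Pairwise (fun i j => Disjoint (A i) (A j)) → iIndepFun (fun i => pointCount Φ (A i)) P

end PointProcess

/-! ### Roads and vehicles -/

/-- The point with signed abscissa `t` on the line with normal direction `p.1` (an angle) and signed
distance `p.2` from the origin; the abscissa is measured from the foot of the perpendicular. -/
noncomputable def linePoint (p : ℝ × ℝ) (t : ℝ) : Plane :=
  !₂[p.2 * Real.cos p.1 - t * Real.sin p.1, p.2 * Real.sin p.1 + t * Real.cos p.1]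

/-- Coordinates `(θ, y)` of the roads: `none` is the typical road, through the origin, with normal
direction `θ₀`; `some n` is the `n`-th line of the Poisson line process. -/
def roadCoord {Ω : Type*} (L : ℕ → Ω → ℝ × ℝ) (θ₀ : Ω → ℝ) : Option ℕ → Ω → ℝ × ℝ
  | none, ω => (θ₀ ω, 0)
  | some n, ω => L n ω

/-- The locations of all vehicles: `V i ω` is the set of abscissae of the vehicles on road `i`. -/
noncomputable def vehicles {Ω : Type*} (L : ℕ → Ω → ℝ × ℝ) (θ₀ : Ω → ℝ)
    (V : Option ℕ → Ω → Set ℝ) (ω : Ω) : Set Plane :=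
  ⋃ i : Option ℕ, linePoint (roadCoord L θ₀ i ω) '' V i ω

/-- `L 0, L 1, …` enumerates, without repetition, the lines of a motion-invariant Poisson line
process of intensity `lamR`: their coordinates `(θ, y)` form a Poisson process on `[0, π) × ℝ` with
`lamR` times Lebesgue measure as its intensity. -/
structure IsPoissonLineProcess {Ω : Type*} [MeasurableSpace Ω] (P : Measure Ω)
    (L : ℕ → Ω → ℝ × ℝ) (lamR : ℝ) : Prop where
  measurable : ∀ n, Measurable (L n)
  injective : ∀ᵐ ω ∂P, Function.Injective (fun n => L n ω)
  poisson : IsPoissonProcess P (fun ω => range (fun n => L n ω))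
    (ENNReal.ofReal lamR • (volume : Measure (ℝ × ℝ)).restrict (Ico 0 Real.pi ×ˢ univ))

/-- Vehicles on the roads: given the lines, they form independent homogeneous Poisson processes of
intensity `μv` on all lines and on the additional typical road through the origin. -/
structure IsVehicleProcess {Ω : Type*} [MeasurableSpace Ω] (P : Measure Ω)
    (L : ℕ → Ω → ℝ × ℝ) (V : Option ℕ → Ω → Set ℝ) (μv : ℝ) : Prop where
  poisson : ∀ i, IsPoissonProcess P (V i) (ENNReal.ofReal μv • (volume : Measure ℝ))
  indep_roads : iIndep (fun i => pointSigma (V i)) P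
  indep_lines : Indep (⨆ n, MeasurableSpace.comap (L n) inferInstance) (⨆ i, pointSigma (V i)) P

/-! ### Distances and the closed-form density -/

/-- The V2V distance: the distance from the origin to the nearest vehicle. -/
noncomputable def distV2V {Ω : Type*} (L : ℕ → Ω → ℝ × ℝ) (θ₀ : Ω → ℝ)
    (V : Option ℕ → Ω → Set ℝ) (ω : Ω) : ℝ :=
  Metric.infDist 0 (vehicles L θ₀ V ω)

/-- The V2B distance: the distance from the location `T` to the nearest base station. -/
noncomputable def distV2B {Ω : Type*} (T : Ω → Plane) (Φb : Ω → Set Plane) (ω : Ω) : ℝ :=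
  Metric.infDist (T ω) (Φb ω)

/-- The closed form of the density of the V2V distance. -/
noncomputable def pdfV2V (lamR μv r : ℝ) : ℝ :=
  -Real.exp (-2 * Real.pi * lamR * r
      + Real.pi ^ 2 * lamR * r * (struveL (-1) (2 * r * μv) - besselI 1 (2 * r * μv))
      - 2 * r * μv)
    * (-2 * Real.pi ^ 2 * lamR * r * μv * (besselI 0 (2 * r * μv) - struveL 0 (2 * r * μv))
      - 2 * μv)

/-!
The distance from the origin to a point of abscissa `t` on the line `(θ, y)` is `√(y ^ 2 + t ^ 2)`,
whatever the angle `θ`. Hence, if there are vehicles at all, which is almost sure, the V2V distance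
is at least `r > 0` exactly when, on every road, the distance `Dᵢ` from the foot of the
perpendicular to the nearest vehicle is at least
`√(r ^ 2 - yᵢ ^ 2)` (`le_distV2V_iff`); a road farther than `r` imposes no condition, in agreement
with the convention that the square root of a negative number is zero. The `Dᵢ` are independent
exponential variables of rate `2 μv`, independent of the lines. Conditioning on the lines, which is
a Fubini argument (`measureReal_mem_eq_integral`), turns the survival function into
`exp (-2 μv r)`, due to the typical road, times the expectation of
`∏ₙ exp (-2 μv √(r ^ 2 - yₙ ^ 2))`.

The latter is a value of the generating functional of the Poisson line process,
`E ∏ₙ g(xₙ) = exp (-∫ (1 - g) dν)` (`IsPoissonProcess.tendsto_integral_prod`). For a simple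
function `g` this is the independence of the counts together with the generating function of the
Poisson law; a general `g` with values in `[0, 1]`, equal to `1` off a set of finite intensity, is a
limit of such functions.

With `y = -r cos x` the integral of `1 - g` becomes `π lamR r (2 - K(z))` at `z = 2 μv r`, where
`K(z) = ∫₀^π sin x exp (-z sin x) dx`. Expanding the exponential and using Wallis' integrals gives
`K = π (L₋₁ - I₁)` and `∫₀^π exp (-z sin x) dx = π (I₀ - L₀)`; an integration by parts gives
`(z K(z))' = 2 - z ∫₀^π exp (-z sin x) dx`. So `pdfV2V` is minus the derivative of the survival
function (`hasDerivAt_survivalV2V`), and the two laws have the same tails (`map_distV2V`).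

For the association probability, the base stations are independent of `T` and of the V2V distance
`R`, so that the disc of radius `(R ^ αv / B) ^ (1 / αb)` about `T` is empty with conditional
probability `exp (-π lamb (R ^ αv / B) ^ (2 / αb))` (`measureReal_le_infEDist_of_indep`). The values
taken by convention, a distance zero to an empty set and the power of a zero distance, occur with
probability zero only (`ae_infEDist_pos_lt_top`).
-/

open scoped Real Topology

open Filter (Tendsto atTop)

/-! ### Integral representations of the Bessel and Struve functions -/

/-- Wallis' integrals in terms of the Gamma function, with the duplication formula absorbed. -/
theorem integral_sin_pow_mul_Gamma (m : ℕ) :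
    (∫ x in (0 : ℝ)..π, Real.sin x ^ m) * 2 ^ m * Real.Gamma (m / 2 + 1) ^ 2
      = π * m.factorial := by
  induction m using Nat.twoStepInduction with
  | zero => simp
  | one =>
    have h : Real.Gamma ((1 : ℕ) / 2 + 1) = 1 / 2 * √π := by
      rw [Nat.cast_one, Real.Gamma_add_one (by norm_num), Real.Gamma_one_half_eq]
    rw [h, mul_pow, Real.sq_sqrt Real.pi_pos.le]
    simp
    ring
  | more n ih _ =>
    have h : Real.Gamma (((n + 2 : ℕ) : ℝ) / 2 + 1)
        = ((n : ℝ) / 2 + 1) * Real.Gamma (n / 2 + 1) := by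
      rw [← Real.Gamma_add_one (by positivity)]
      congr 1
      push_cast
      ring
    rw [h, integral_sin_pow, Nat.factorial_succ, Nat.factorial_succ]
    have h2 : (n : ℝ) + 2 ≠ 0 := by positivity
    simp only [Real.sin_zero, Real.sin_pi, ne_eq, Nat.add_eq_zero_iff, one_ne_zero, and_false,
      not_false_eq_true, zero_pow, zero_mul, sub_zero, zero_div, zero_add]
    push_cast
    have : (n + 1 : ℝ) / (n + 2) * (∫ x in (0 : ℝ)..π, Real.sin x ^ n) * 2 ^ (n + 2)
        * (((n : ℝ) / 2 + 1) * Real.Gamma (n / 2 + 1)) ^ 2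
        = (n + 1) * (n + 2) * ((∫ x in (0 : ℝ)..π, Real.sin x ^ n) * 2 ^ n
          * Real.Gamma (n / 2 + 1) ^ 2) := by
      field_simp
      ring
    rw [this, ih]
    ring

/-- Expand the exponential and integrate term by term. -/
theorem hasSum_integral_sin_pow_mul_exp (p : ℕ) (z : ℝ) :
    HasSum (fun m : ℕ => (-z) ^ m / m.factorial * ∫ x in (0 : ℝ)..π, Real.sin x ^ (m + p))
      (∫ x in (0 : ℝ)..π, Real.sin x ^ p * Real.exp (-z * Real.sin x)) := by
  have key : HasSum (fun m : ℕ => ∫ x in (0 : ℝ)..π,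
        Real.sin x ^ p * ((-z * Real.sin x) ^ m / m.factorial))
      (∫ x in (0 : ℝ)..π, Real.sin x ^ p * Real.exp (-z * Real.sin x)) := by
    apply intervalIntegral.hasSum_integral_of_dominated_convergence
      (fun m _ => |z| ^ m / m.factorial)
    · intro m
      exact Continuous.aestronglyMeasurable (by fun_prop)
    · intro m
      refine Filter.Eventually.of_forall fun x _ => ?_
      rw [Real.norm_eq_abs, abs_mul, abs_pow, abs_div, abs_pow, abs_mul, abs_neg, Nat.abs_cast]
      have h1 : |Real.sin x| ≤ 1 := Real.abs_sin_le_one x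
      calc |Real.sin x| ^ p * ((|z| * |Real.sin x|) ^ m / m.factorial)
          ≤ 1 * ((|z| * 1) ^ m / m.factorial) := by
            gcongr
            exact pow_le_one₀ (abs_nonneg _) h1
        _ = _ := by rw [one_mul, mul_one]
    · exact Filter.Eventually.of_forall fun x _ => Real.summable_pow_div_factorial |z|
    · exact intervalIntegrable_const
    · refine Filter.Eventually.of_forall fun x _ => ?_
      have := NormedSpace.expSeries_div_hasSum_exp (-z * Real.sin x)
      rw [← Real.exp_eq_exp_ℝ] at this
      exact this.mul_left _
  refine key.congr_fun fun m => ?_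
  rw [← intervalIntegral.integral_const_mul]
  refine intervalIntegral.integral_congr fun x _ => ?_
  simp only [mul_pow, pow_add]
  ring

/-- The Bessel function collects the terms of one parity, the Struve function those of the other. -/
theorem tsum_even_sub_odd {a b c : ℕ → ℝ} {s : ℝ} (h : HasSum a s)
    (hb : ∀ k, a (2 * k) = b k) (hc : ∀ k, a (2 * k + 1) = -c k) :
    ∑' k, b k - ∑' k, c k = s := by
  have he : Summable fun k => a (2 * k) :=
    h.summable.comp_injective (mul_right_injective₀ two_ne_zero)
  have ho : Summable fun k => a (2 * k + 1) :=
    h.summable.comp_injective fun x y hxy => by simpa using hxy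
  have := tsum_even_add_odd he ho
  rw [h.tsum_eq] at this
  simp only [hb, hc, tsum_neg] at this
  linarith

theorem besselI_zero_sub_struveL_zero (z : ℝ) :
    besselI 0 z - struveL 0 z = (∫ x in (0 : ℝ)..π, Real.exp (-z * Real.sin x)) / π := by
  have h := (hasSum_integral_sin_pow_mul_exp 0 z).div_const π
  simp only [pow_zero, one_mul, add_zero] at h
  have hG (m : ℕ) : (-z) ^ m / m.factorial * (∫ x in (0 : ℝ)..π, Real.sin x ^ m) / π
      = (-(z / 2)) ^ m / Real.Gamma (m / 2 + 1) ^ 2 := by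
    have h0 : Real.Gamma ((m : ℝ) / 2 + 1) ≠ 0 := (Real.Gamma_pos_of_pos (by positivity)).ne'
    have h1 := integral_sin_pow_mul_Gamma m
    rw [← neg_div, div_pow]
    generalize Real.Gamma ((m : ℝ) / 2 + 1) = G at *
    field_simp
    linear_combination (-z) ^ m * h1
  refine tsum_even_sub_odd h (fun k => ?_) (fun k => ?_)
  · rw [hG, Even.neg_pow ⟨k, by ring⟩]
    have e1 : 2 * (k : ℤ) + 0 = ((2 * k : ℕ) : ℤ) := by push_cast; ring
    have e2 : ((2 * k : ℕ) : ℝ) / 2 + 1 = k + 1 := by push_cast; ring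
    rw [e1, zpow_natCast, e2, Int.cast_zero, add_zero, Real.Gamma_nat_eq_factorial, sq]
  · rw [hG, Odd.neg_pow ⟨k, by ring⟩]
    have e1 : 2 * (k : ℤ) + 0 + 1 = ((2 * k + 1 : ℕ) : ℤ) := by push_cast; ring
    have e2 : ((2 * k + 1 : ℕ) : ℝ) / 2 + 1 = k + 3 / 2 := by push_cast; ring
    rw [e1, zpow_natCast, e2, Int.cast_zero, add_zero, sq, neg_div]

theorem struveL_neg_one_sub_besselI_one (z : ℝ) :
    struveL (-1) z - besselI 1 z
      = (∫ x in (0 : ℝ)..π, Real.sin x * Real.exp (-z * Real.sin x)) / π := by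
  have h := (hasSum_integral_sin_pow_mul_exp 1 z).div_const π
  simp only [pow_one] at h
  have hG (m : ℕ) : (-z) ^ m / m.factorial * (∫ x in (0 : ℝ)..π, Real.sin x ^ (m + 1)) / π
      = (-(z / 2)) ^ m / (Real.Gamma (((m + 1 : ℕ) : ℝ) / 2 + 1)
          * Real.Gamma (((m + 1 : ℕ) : ℝ) / 2)) := by
    have h0 : Real.Gamma (((m + 1 : ℕ) : ℝ) / 2) ≠ 0 :=
      (Real.Gamma_pos_of_pos (by positivity)).ne'
    have h2 : (((m + 1 : ℕ) : ℝ) / 2) ≠ 0 := by positivity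
    have h1 := integral_sin_pow_mul_Gamma (m + 1)
    rw [Nat.factorial_succ] at h1
    rw [Real.Gamma_add_one h2] at h1 ⊢
    rw [← neg_div, div_pow]
    push_cast at *
    have h3 : (m : ℝ) + 1 ≠ 0 := by positivity
    have h4 : (∫ x in (0 : ℝ)..π, Real.sin x ^ (m + 1)) * 2 ^ m
        * ((m + 1) * Real.Gamma ((m + 1) / 2) ^ 2) = 2 * π * m.factorial := by
      apply mul_left_cancel₀ h3
      rw [pow_succ (2 : ℝ)] at h1
      linear_combination 2 * h1
    field_simp
    linear_combination (-z) ^ m * h4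
  refine tsum_even_sub_odd h (fun k => ?_) (fun k => ?_)
  · rw [hG, Even.neg_pow ⟨k, by ring⟩]
    have e1 : 2 * (k : ℤ) + -1 + 1 = ((2 * k : ℕ) : ℤ) := by push_cast; ring
    have e2 : ((2 * k + 1 : ℕ) : ℝ) / 2 + 1 = k + 3 / 2 := by push_cast; ring
    have e3 : ((2 * k + 1 : ℕ) : ℝ) / 2 = k + (-1 : ℤ) + 3 / 2 := by push_cast; ring
    rw [e1, zpow_natCast, e2, e3]
  · rw [hG, Odd.neg_pow ⟨k, by ring⟩]
    have e1 : 2 * (k : ℤ) + 1 = ((2 * k + 1 : ℕ) : ℤ) := by push_cast; ring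
    have e2 : ((2 * k + 1 + 1 : ℕ) : ℝ) / 2 + 1 = k + (1 : ℤ) + 1 := by push_cast; ring
    have e3 : ((2 * k + 1 + 1 : ℕ) : ℝ) / 2 = k + 1 := by push_cast; ring
    rw [e1, zpow_natCast, e2, e3, Real.Gamma_nat_eq_factorial, mul_comm (Real.Gamma _), neg_div]

/-- Integration by parts, with `cos ^ 2 = 1 - sin ^ 2`. -/
theorem integral_sin_mul_exp_eq (z : ℝ) :
    (∫ x in (0 : ℝ)..π, Real.sin x * Real.exp (-z * Real.sin x))
      = 2 - z * (∫ x in (0 : ℝ)..π, Real.exp (-z * Real.sin x))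
        + z * ∫ x in (0 : ℝ)..π, Real.sin x ^ 2 * Real.exp (-z * Real.sin x) := by
  have hd : ∀ x ∈ uIcc (0 : ℝ) π, HasDerivAt
      (fun x => -Real.cos x * Real.exp (-z * Real.sin x))
      (Real.sin x * Real.exp (-z * Real.sin x) + z * (Real.exp (-z * Real.sin x)
        - Real.sin x ^ 2 * Real.exp (-z * Real.sin x))) x := fun x _ => by
    have h1 := (Real.hasDerivAt_cos x).neg
    have h2 := ((Real.hasDerivAt_sin x).const_mul (-z)).exp
    refine (h1.mul h2).congr_deriv ?_
    rw [Real.sin_sq]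
    simp only [Pi.neg_apply]
    ring
  have hi := intervalIntegral.integral_eq_sub_of_hasDerivAt hd
    (Continuous.intervalIntegrable (by fun_prop) _ _)
  have c1 : IntervalIntegrable (fun x => Real.sin x * Real.exp (-z * Real.sin x)) volume 0 π :=
    Continuous.intervalIntegrable (by fun_prop) _ _
  have c2 : IntervalIntegrable (fun x => Real.exp (-z * Real.sin x)) volume 0 π :=
    Continuous.intervalIntegrable (by fun_prop) _ _
  have c3 : IntervalIntegrable (fun x => Real.sin x ^ 2 * Real.exp (-z * Real.sin x))
    volume 0 π := Continuous.intervalIntegrable (by fun_prop) _ _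
  rw [intervalIntegral.integral_add c1 ((c2.sub c3).const_mul z),
    intervalIntegral.integral_const_mul, intervalIntegral.integral_sub c2 c3] at hi
  simp at hi
  simp only [neg_mul]
  linarith

theorem hasDerivAt_mul_integral_sin_mul_exp (z : ℝ) :
    HasDerivAt (fun z => z * ∫ x in (0 : ℝ)..π, Real.sin x * Real.exp (-z * Real.sin x))
      (2 - z * ∫ x in (0 : ℝ)..π, Real.exp (-z * Real.sin x)) z := by
  have h := (intervalIntegral.hasDerivAt_integral_of_dominated_loc_of_deriv_le
    (μ := volume) (a := 0) (b := π) (x₀ := z) (s := Ioo (z - 1) (z + 1))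
    (F := fun z x => Real.sin x * Real.exp (-z * Real.sin x))
    (F' := fun z x => -(Real.sin x ^ 2 * Real.exp (-z * Real.sin x)))
    (bound := fun _ => Real.exp (|z| + 1)) (Ioo_mem_nhds (by linarith) (by linarith))
    (Filter.Eventually.of_forall fun y => Continuous.aestronglyMeasurable (by fun_prop))
    (Continuous.intervalIntegrable (by fun_prop) _ _)
    (Continuous.aestronglyMeasurable (by fun_prop))
    (Filter.Eventually.of_forall fun x _ y hy => ?_) intervalIntegrable_const
    (Filter.Eventually.of_forall fun x _ y hy => ?_)).2
  · refine ((hasDerivAt_id' z).mul h).congr_deriv ?_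
    rw [intervalIntegral.integral_neg, integral_sin_mul_exp_eq]
    ring
  · rw [norm_neg, Real.norm_eq_abs, abs_mul, Real.abs_exp, abs_pow]
    have h1 : |Real.sin x| ≤ 1 := Real.abs_sin_le_one x
    have hy' : |y| ≤ |z| + 1 := by
      have := abs_sub_abs_le_abs_sub y z
      have : |y - z| < 1 := abs_lt.2 ⟨by linarith [hy.1], by linarith [hy.2]⟩
      linarith
    calc |Real.sin x| ^ 2 * Real.exp (-y * Real.sin x) ≤ 1 * Real.exp (|z| + 1) := by
          gcongr
          · exact pow_le_one₀ (abs_nonneg _) h1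
          · calc -y * Real.sin x ≤ |-y * Real.sin x| := le_abs_self _
              _ = |y| * |Real.sin x| := by rw [abs_mul, abs_neg]
              _ ≤ |y| * 1 := by gcongr
              _ ≤ |z| + 1 := by linarith
      _ = _ := one_mul _
  · have := (((hasDerivAt_id' y).neg.mul_const (Real.sin x)).exp).const_mul (Real.sin x)
    refine this.congr_deriv ?_
    simp only [Pi.neg_apply]
    ring

/-- The substitution `y = -r cos x`. -/
theorem integral_one_sub_exp_sqrt {r : ℝ} (hr : 0 ≤ r) (c : ℝ) :
    (∫ y in -r..r, (1 - Real.exp (-(c * √(r ^ 2 - y ^ 2)))))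
      = 2 * r - r * ∫ x in (0 : ℝ)..π, Real.sin x * Real.exp (-(r * c) * Real.sin x) := by
  have h := intervalIntegral.integral_comp_mul_deriv (a := 0) (b := π)
    (f := fun x => -r * Real.cos x) (f' := fun x => -r * -Real.sin x)
    (g := fun y => 1 - Real.exp (-(c * √(r ^ 2 - y ^ 2))))
    (fun x _ => (Real.hasDerivAt_cos x).const_mul (-r)) (by fun_prop) (by fun_prop)
  simp only [Function.comp_def, Real.cos_zero, mul_one, Real.cos_pi, mul_neg, neg_neg,
    neg_mul] at h
  rw [← h]
  have hs : ∀ x ∈ uIcc (0 : ℝ) π, (1 - Real.exp (-(c * √(r ^ 2 - (-(r * Real.cos x)) ^ 2))))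
      * (r * Real.sin x)
      = r * Real.sin x - r * (Real.sin x * Real.exp (-(r * c) * Real.sin x)) := by
    intro x hx
    rw [uIcc_of_le Real.pi_pos.le] at hx
    have : r ^ 2 - (-(r * Real.cos x)) ^ 2 = (r * Real.sin x) ^ 2 := by
      rw [mul_pow, Real.sin_sq]; ring
    rw [this, Real.sqrt_sq (mul_nonneg hr (Real.sin_nonneg_of_mem_Icc hx)),
      show -(c * (r * Real.sin x)) = -(r * c) * Real.sin x by ring]
    ring
  rw [intervalIntegral.integral_congr hs, intervalIntegral.integral_sub
    (Continuous.intervalIntegrable (by fun_prop) _ _)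
    (Continuous.intervalIntegrable (by fun_prop) _ _), intervalIntegral.integral_const_mul,
    intervalIntegral.integral_const_mul, integral_sin]
  simp
  ring

/-! ### Poisson processes: void probabilities and the generating functional -/

theorem measurableSet_pointSigma_inter_eq_empty {Ω X : Type*} [MeasurableSpace X]
    (Φ : Ω → Set X) {A : Set X}
    (hA : MeasurableSet A) : MeasurableSet[pointSigma Φ] {ω | Φ ω ∩ A = ∅} := by
  refine le_iSup (fun A : {A : Set X // MeasurableSet A} =>
    MeasurableSpace.comap (pointCount Φ A) ⊤) ⟨A, hA⟩ _ ⟨{0}, trivial, ?_⟩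
  ext ω
  simp [pointCount]

theorem measurable_infEDist_pointSigma {Ω E : Type*} [PseudoEMetricSpace E] [MeasurableSpace E]
    [OpensMeasurableSpace E] (Φ : Ω → Set E) (t : E) :
    Measurable[pointSigma Φ] fun ω => Metric.infEDist t (Φ ω) := by
  refine measurable_of_Ici fun s => ?_
  convert measurableSet_pointSigma_inter_eq_empty Φ
    (Metric.isOpen_eball (x := t) (ε := s)).measurableSet using 1
  ext ω
  simp only [mem_preimage, mem_Ici, mem_ofPred_eq, Metric.le_infEDist,
    eq_empty_iff_forall_notMem, mem_inter_iff, not_and, Metric.mem_eball, not_lt, edist_comm t]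

theorem toNat_pointCount_range {Ω X : Type*} {x : ℕ → Ω → X} {ω : Ω}
    (hinj : Function.Injective fun n => x n ω) (A : Set X) :
    (pointCount (fun ω => range fun n => x n ω) A ω).toNat = {n | x n ω ∈ A}.ncard := by
  have : (range fun n => x n ω) ∩ A = (fun n => x n ω) '' {n | x n ω ∈ A} := by
    ext y
    constructor
    · rintro ⟨⟨n, rfl⟩, hn⟩
      exact ⟨n, hn, rfl⟩
    · rintro ⟨n, hn, rfl⟩
      exact ⟨⟨n, rfl⟩, hn⟩
  rw [pointCount, this, hinj.encard_image, Set.ncard]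

/-- Outside `A` all factors are `1`, so the infinite product is a finite one. -/
theorem tendsto_prod_range_finprod {Ω X : Type*} {x : ℕ → Ω → X} {ω : Ω} {g : X → ℝ} {A : Set X}
    (hfin : {n | x n ω ∈ A}.Finite) (hg : ∀ y ∉ A, g y = 1) :
    Tendsto (fun N => ∏ n ∈ Finset.range N, g (x n ω)) atTop (𝓝 (∏ᶠ n, g (x n ω))) := by
  refine tendsto_const_nhds.congr' ?_
  obtain ⟨M, hM⟩ := hfin.bddAbove
  filter_upwards [Filter.eventually_gt_atTop M] with N hN
  refine finprod_eq_prod_of_mulSupport_subset _ fun n hn => ?_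
  by_contra hnN
  refine hn (hg _ fun hA => hnN ?_)
  have : n ≤ M := hM hA
  simpa using lt_of_le_of_lt this hN

theorem abs_prod_le_one {s : Finset ℕ} {f : ℕ → ℝ} (h0 : ∀ n, 0 ≤ f n) (h1 : ∀ n, f n ≤ 1) :
    |∏ n ∈ s, f n| ≤ 1 := by
  rw [abs_of_nonneg (Finset.prod_nonneg fun n _ => h0 n)]
  exact Finset.prod_le_one (fun n _ => h0 n) fun n _ => h1 n

section PoissonProcess

variable {Ω X : Type*} [MeasurableSpace Ω] [MeasurableSpace X] {P : Measure Ω} {ν : Measure X}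

theorem pointSigma_le {Φ : Ω → Set X}
    (h : ∀ A, MeasurableSet A → Measurable (pointCount Φ A)) :
    pointSigma Φ ≤ ‹MeasurableSpace Ω› :=
  iSup_le fun A => (h A A.2).comap_le

namespace IsPoissonProcess

variable {Φ : Ω → Set X}

theorem measure_inter_eq_empty (h : IsPoissonProcess P Φ ν) {A : Set X} (hA : MeasurableSet A)
    (hνA : ν A ≠ ⊤) : P {ω | Φ ω ∩ A = ∅} = ENNReal.ofReal (Real.exp (-ν.real A)) := by
  have h1 := congrArg (fun m => m {0}) (h.law_count A hA hνA)
  rw [Measure.map_apply (h.measurable_count A hA) (measurableSet_singleton _),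
    Measure.map_apply .of_discrete (measurableSet_singleton _)] at h1
  have e1 : pointCount Φ A ⁻¹' {0} = {ω | Φ ω ∩ A = ∅} := by
    ext ω
    simp [pointCount]
  have e2 : (fun k : ℕ => (k : ℕ∞)) ⁻¹' {0} = {0} := by
    ext k
    simp
  rw [e1, e2, poissonMeasure_singleton] at h1
  simpa [Measure.real, ENNReal.coe_toNNReal_eq_toReal] using h1

theorem ae_finite_inter (h : IsPoissonProcess P Φ ν) {A : Set X} (hA : MeasurableSet A)
    (hνA : ν A ≠ ⊤) : ∀ᵐ ω ∂P, (Φ ω ∩ A).Finite := by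
  have h1 := congrArg (fun m => m {⊤}) (h.law_count A hA hνA)
  rw [Measure.map_apply (h.measurable_count A hA) (measurableSet_singleton _),
    Measure.map_apply .of_discrete (measurableSet_singleton _)] at h1
  have e2 : (fun k : ℕ => (k : ℕ∞)) ⁻¹' {⊤} = ∅ := by
    ext k
    simp
  rw [e2, measure_empty] at h1
  rw [ae_iff]
  convert h1 using 2
  ext ω
  simp only [mem_ofPred_eq, mem_preimage, mem_singleton_iff, pointCount,
    Set.encard_eq_top_iff]
  rfl

theorem integral_pow_pointCount (h : IsPoissonProcess P Φ ν) {A : Set X} (hA : MeasurableSet A)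
    (hνA : ν A ≠ ⊤) (c : ℝ) :
    ∫ ω, c ^ (pointCount Φ A ω).toNat ∂P = Real.exp (-((1 - c) * ν.real A)) := by
  have h1 := integral_map (μ := P) (φ := pointCount Φ A) (f := fun k : ℕ∞ => c ^ k.toNat)
    (h.measurable_count A hA).aemeasurable .of_discrete
  rw [← h1, h.law_count A hA hνA, integral_map .of_discrete .of_discrete,
    integral_poissonMeasure]
  simp only [ENat.toNat_natCast, smul_eq_mul]
  have h2 := (NormedSpace.expSeries_div_hasSum_exp ((ν A).toReal * c)).mul_left
    (Real.exp (-(ν A).toReal))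
  rw [← Real.exp_eq_exp_ℝ, ← Real.exp_add] at h2
  rw [show -((1 - c) * ν.real A) = -(ν A).toReal + (ν A).toReal * c by
    rw [Measure.real]; ring, ← h2.tsum_eq]
  refine tsum_congr fun n => ?_
  rw [mul_pow]
  simp only [ENNReal.coe_toNNReal_eq_toReal]
  ring

variable {x : ℕ → Ω → X}

theorem ae_finite_setOf_mem (h : IsPoissonProcess P (fun ω => range fun n => x n ω) ν)
    (hinj : ∀ᵐ ω ∂P, Function.Injective fun n => x n ω) {A : Set X} (hA : MeasurableSet A)
    (hνA : ν A ≠ ⊤) : ∀ᵐ ω ∂P, {n | x n ω ∈ A}.Finite := by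
  filter_upwards [h.ae_finite_inter hA hνA, hinj] with ω h1 h2
  have := h1.preimage h2.injOn
  refine this.subset fun n hn => ⟨⟨n, rfl⟩, hn⟩

/-- On a simple function the generating functional factors over the level sets, by the
independence of the counts. -/
theorem integral_finprod_simpleFunc [IsFiniteMeasure P]
    (h : IsPoissonProcess P (fun ω => range fun n => x n ω) ν)
    (hinj : ∀ᵐ ω ∂P, Function.Injective fun n => x n ω) {A : Set X} (hA : MeasurableSet A)
    (hνA : ν A ≠ ⊤) (g : SimpleFunc X ℝ) (hg : ∀ y ∉ A, g y = 1) :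
    ∫ ω, ∏ᶠ n, g (x n ω) ∂P = Real.exp (-∫ y, (1 - g y) ∂ν) := by
  classical
  set Φ : Ω → Set X := fun ω => range fun n => x n ω
  let S (c : ℝ) : Set X := g ⁻¹' {c} ∩ A
  have hS (c : ℝ) : MeasurableSet (S c) := (g.measurableSet_fiber c).inter hA
  have hνS (c : ℝ) : ν (S c) ≠ ⊤ := measure_ne_top_of_subset inter_subset_right hνA
  have hdisj : Pairwise fun c d => Disjoint (S c) (S d) := fun c d hcd =>
    Set.disjoint_left.2 fun y hy hy' => hcd (hy.1.symm.trans hy'.1)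
  -- group the factors by their value
  have hprod : ∀ᵐ ω ∂P, ∏ᶠ n, g (x n ω)
      = ∏ c : g.range, (c : ℝ) ^ (pointCount Φ (S c) ω).toNat := by
    filter_upwards [h.ae_finite_setOf_mem hinj hA hνA, hinj] with ω hfin hω
    rw [finprod_eq_prod_of_mulSupport_subset (s := hfin.toFinset) _ fun n hn => by
        simp only [Finite.coe_toFinset, mem_ofPred_eq]
        by_contra hnA
        exact hn (hg _ hnA),
      ← Finset.prod_fiberwise_of_maps_to (t := g.range) (g := fun n => g (x n ω))
        fun n _ => g.mem_range_self _, ← Finset.prod_coe_sort]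
    refine Finset.prod_congr rfl fun c _ => ?_
    rw [Finset.prod_congr rfl fun n hn => (Finset.mem_filter.1 hn).2, Finset.prod_const,
      toNat_pointCount_range hω, ← Set.ncard_coe_finset]
    congr 2
    ext n
    simp [S, and_comm]
  -- `indep_count` speaks of families indexed by `Fin m`: enumerate the values of `g`
  have hind : iIndepFun (fun c : g.range => pointCount Φ (S c)) P := by
    have e := Fintype.equivFin g.range
    have := h.indep_count (Fintype.card g.range) (fun i => S (e.symm i)) (fun i => hS _)
      fun i j hij => hdisj fun hc => hij (e.symm.injective (Subtype.ext hc))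
    have h2 := this.precomp e.injective
    simpa using h2
  have hint : ∫ y, (1 - g y) ∂ν = ∑ c : g.range, (1 - (c : ℝ)) * ν.real (S c) := by
    have e : (fun y => 1 - g y)
        = fun y => ∑ c : g.range, (S c).indicator (fun _ => 1 - (c : ℝ)) y := by
      ext y
      by_cases hy : y ∈ A
      · rw [Finset.sum_eq_single ⟨g y, g.mem_range_self y⟩]
        · rw [indicator_of_mem (show y ∈ S (g y) from ⟨rfl, hy⟩)]
        · intro c _ hc
          exact indicator_of_notMem (fun hyc => hc (Subtype.ext hyc.1.symm)) _
        · simp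
      · rw [hg y hy, sub_self, Finset.sum_eq_zero]
        exact fun c _ => indicator_of_notMem (fun hyc => hy hyc.2) _
    rw [e, integral_finsetSum]
    · refine Finset.sum_congr rfl fun c _ => ?_
      rw [integral_indicator_const _ (hS c), smul_eq_mul, mul_comm]
    · exact fun c _ => (integrable_indicator_iff (hS c)).2 (integrableOn_const (hνS c))
  rw [integral_congr_ae hprod, hind.integral_fun_prod_comp 
      (f := fun (c : g.range) (k : ℕ∞) => (c : ℝ) ^ k.toNat)
    (fun c => (h.measurable_count _ (hS c)).aemeasurable) fun c => .of_discrete, hint,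
    ← Finset.sum_neg_distrib, Real.exp_sum]
  exact Finset.prod_congr rfl fun c _ => h.integral_pow_pointCount (hS c) (hνS c) c

/-- The generating functional of a Poisson process:
`E ∏ₙ g(xₙ) = exp (-∫ (1 - g) dν)`. -/
theorem tendsto_integral_prod [IsFiniteMeasure P]
    (h : IsPoissonProcess P (fun ω => range fun n => x n ω) ν) (hx : ∀ n, Measurable (x n))
    (hinj : ∀ᵐ ω ∂P, Function.Injective fun n => x n ω) {A : Set X} (hA : MeasurableSet A)
    (hνA : ν A ≠ ⊤) {g : X → ℝ} (hgm : Measurable g) (hg01 : ∀ y, g y ∈ Icc (0 : ℝ) 1)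
    (hg : ∀ y ∉ A, g y = 1) :
    Tendsto (fun N => ∫ ω, ∏ n ∈ Finset.range N, g (x n ω) ∂P) atTop
      (𝓝 (Real.exp (-∫ y, (1 - g y) ∂ν))) := by
  have hfin := h.ae_finite_setOf_mem hinj hA hνA
  have hmeas {f : X → ℝ} (hf : Measurable f) (N : ℕ) :
      AEStronglyMeasurable (fun ω => ∏ n ∈ Finset.range N, f (x n ω)) P :=
    (Finset.measurable_fun_prod _ fun n _ => hf.comp (hx n)).aestronglyMeasurable
  have hone : (1 : ℝ) ∈ Icc (0 : ℝ) 1 := by simp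
  let G (k : ℕ) : SimpleFunc X ℝ := SimpleFunc.approxOn g hgm (Icc 0 1) 1 hone k
  have hG01 (k : ℕ) (y : X) : G k y ∈ Icc (0 : ℝ) 1 := SimpleFunc.approxOn_mem hgm hone k y
  -- the first approximating value is `1`, so the approximation is exact off `A`
  have hGone (k : ℕ) (y : X) (hy : y ∉ A) : G k y = 1 := by
    have := SimpleFunc.edist_approxOn_y0_le hgm hone y k
    rw [hg y hy, edist_self, add_zero, nonpos_iff_eq_zero, edist_eq_zero] at this
    exact this.symm
  have hGlim (y : X) : Tendsto (fun k => G k y) atTop (𝓝 (g y)) :=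
    SimpleFunc.tendsto_approxOn hgm hone (subset_closure (hg01 y))
  have hlim : ∫ ω, ∏ᶠ n, g (x n ω) ∂P = Real.exp (-∫ y, (1 - g y) ∂ν) := by
    have h1 : Tendsto (fun k => ∫ ω, ∏ᶠ n, G k (x n ω) ∂P) atTop
        (𝓝 (∫ ω, ∏ᶠ n, g (x n ω) ∂P)) := by
      refine tendsto_integral_of_dominated_convergence (fun _ => 1) (fun k => ?_)
        (integrable_const _) (fun k => ?_) ?_
      · refine aestronglyMeasurable_of_tendsto_ae atTop (hmeas (G k).measurable) ?_
        filter_upwards [hfin] with ω hω using tendsto_prod_range_finprod hω (hGone k)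
      · filter_upwards [hfin] with ω hω
        refine le_of_tendsto (tendsto_prod_range_finprod hω (hGone k)).norm
          (Filter.Eventually.of_forall fun N => ?_)
        exact abs_prod_le_one (fun n => (hG01 k _).1) fun n => (hG01 k _).2
      · filter_upwards [hfin] with ω hω
        have e {f : X → ℝ} (hf : ∀ y ∉ A, f y = 1) :
            ∏ᶠ n, f (x n ω) = ∏ n ∈ hω.toFinset, f (x n ω) :=
          finprod_eq_prod_of_mulSupport_subset _ fun n hn => by
            simp only [Finite.coe_toFinset, mem_ofPred_eq]
            by_contra hnA
            exact hn (hf _ hnA)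
        rw [e hg]
        simp_rw [fun k => e (hGone k)]
        exact tendsto_finsetProd _ fun n _ => hGlim _
    have h2 : Tendsto (fun k => ∫ y, (1 - G k y) ∂ν) atTop (𝓝 (∫ y, (1 - g y) ∂ν)) := by
      refine tendsto_integral_of_dominated_convergence (A.indicator fun _ => 1) (fun k => ?_)
        ((integrable_indicator_iff hA).2 (integrableOn_const hνA)) (fun k => ?_) ?_
      · exact (measurable_const.sub (G k).measurable).aestronglyMeasurable
      · refine Filter.Eventually.of_forall fun y => ?_
        by_cases hy : y ∈ A
        · rw [indicator_of_mem hy, Real.norm_eq_abs, abs_le]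
          constructor <;> linarith [(hG01 k y).1, (hG01 k y).2]
        · simp [hGone k y hy, hy]
      · exact Filter.Eventually.of_forall fun y => tendsto_const_nhds.sub (hGlim y)
    refine tendsto_nhds_unique h1 ?_
    simp_rw [fun k => h.integral_finprod_simpleFunc hinj hA hνA (G k) (hGone k)]
    exact (Real.continuous_exp.tendsto _).comp h2.neg
  rw [← hlim]
  refine tendsto_integral_of_dominated_convergence (fun _ => 1) (hmeas hgm)
    (integrable_const _) (fun N => ?_) ?_
  · exact Filter.Eventually.of_forall fun ω =>
      abs_prod_le_one (fun n => (hg01 _).1) fun n => (hg01 _).2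
  · filter_upwards [hfin] with ω hω using tendsto_prod_range_finprod hω hg

/-- The points of `Φ` avoid the ball of radius `s` exactly when the distance to `Φ` is at
least `s`. -/
theorem measure_le_infEDist {E : Type*} [PseudoEMetricSpace E] [MeasurableSpace E]
    [OpensMeasurableSpace E] {Φ : Ω → Set E} {ν : Measure E} (h : IsPoissonProcess P Φ ν) (t : E)
    (s : ENNReal) (hν : ν (Metric.eball t s) ≠ ⊤) :
    P {ω | s ≤ Metric.infEDist t (Φ ω)}
      = ENNReal.ofReal (Real.exp (-ν.real (Metric.eball t s))) := by
  rw [← h.measure_inter_eq_empty Metric.isOpen_eball.measurableSet hν]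
  congr 1
  ext ω
  simp only [mem_ofPred_eq, Metric.le_infEDist, eq_empty_iff_forall_notMem, mem_inter_iff,
    not_and, Metric.mem_eball, not_lt, edist_comm t]

end IsPoissonProcess

end PoissonProcess

/-! ### Independent variables held fixed, and variables finite almost surely -/

/-- Freezing lemma: an independent variable may be held fixed and averaged afterwards. -/
theorem measureReal_mem_eq_integral {Ω E F : Type*} {mΩ : MeasurableSpace Ω}
    {mE : MeasurableSpace E} {mF : MeasurableSpace F} {P : Measure Ω} [IsProbabilityMeasure P]
    {X : Ω → E} {Y : Ω → F} (hX : Measurable X) (hY : Measurable Y) (hXY : IndepFun X Y P)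
    {S : Set (E × F)} (hS : MeasurableSet S) :
    P.real {ω | (X ω, Y ω) ∈ S} = ∫ ω, P.real {ω' | (X ω, Y ω') ∈ S} ∂P := by
  have h1 : P {ω | (X ω, Y ω) ∈ S} = ∫⁻ ω, P {ω' | (X ω, Y ω') ∈ S} ∂P := by
    have : P {ω | (X ω, Y ω) ∈ S} = P.map (fun ω => (X ω, Y ω)) S :=
      (Measure.map_apply (hX.prodMk hY) hS).symm
    rw [this, (indepFun_iff_map_prod_eq_prod_map_map hX.aemeasurable hY.aemeasurable).1 hXY,
      Measure.prod_apply hS, lintegral_map (measurable_measure_prodMk_left hS) hX]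
    refine lintegral_congr fun ω => ?_
    rw [Measure.map_apply hY (measurable_prodMk_left hS)]
    rfl
  have h2 : Measurable fun ω => P {ω' | (X ω, Y ω') ∈ S} := by
    have e : (fun ω => P {ω' | (X ω, Y ω') ∈ S})
        = (fun x => P.map Y (Prod.mk x ⁻¹' S)) ∘ X := by
      ext ω
      simp only [Function.comp_apply]
      rw [Measure.map_apply hY (measurable_prodMk_left hS)]
      rfl
    rw [e]
    exact (measurable_measure_prodMk_left hS).comp hX
  simp only [Measure.real]
  rw [h1, integral_toReal h2.aemeasurable
    (Filter.Eventually.of_forall fun ω => measure_lt_top _ _)]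

theorem comap_pi_le {Ω ι : Type*} {β : ι → Type*} [∀ i, MeasurableSpace (β i)]
    {m : MeasurableSpace Ω} {f : ∀ i, Ω → β i} (hf : ∀ i, Measurable[m] (f i)) :
    MeasurableSpace.comap (fun ω i => f i ω) MeasurableSpace.pi ≤ m :=
  (measurable_pi_lambda _ hf).comap_le

theorem ae_lt_top_of_tendsto {Ω : Type*} [MeasurableSpace Ω] {P : Measure Ω}
    {Z : Ω → ENNReal} {u : ℝ → ℝ}
    (h : ∀ s : ℝ, 0 < s → P {ω | ENNReal.ofReal s ≤ Z ω} ≤ ENNReal.ofReal (u s))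
    (hu : Tendsto u atTop (𝓝 0)) : ∀ᵐ ω ∂P, Z ω < ⊤ := by
  rw [ae_iff, ← nonpos_iff_eq_zero]
  have h2 := (ENNReal.continuous_ofReal.tendsto 0).comp hu
  rw [ENNReal.ofReal_zero] at h2
  refine ge_of_tendsto h2 ?_
  filter_upwards [Filter.eventually_gt_atTop 0] with s hs
  refine (measure_mono fun ω hω => ?_).trans (h s hs)
  have : Z ω = ⊤ := by simpa using hω
  simp [this]

/-! ### The survival function of the V2V distance -/

/-- The probability that no vehicle lies within distance `r > 0` of the origin: the typical road
contributes `exp (-2 μv r)`, the other roads contribute the generating functional of the line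
process. -/
noncomputable def survivalV2V (lamR μv r : ℝ) : ℝ :=
  Real.exp (-(2 * μv * r) - lamR * (π * (2 * r
    - r * ∫ x in (0 : ℝ)..π, Real.sin x * Real.exp (-(r * (2 * μv)) * Real.sin x))))

section Survival

variable {lamR μv : ℝ}

theorem pdfV2V_eq (lamR μv r : ℝ) :
    pdfV2V lamR μv r = survivalV2V lamR μv r * (2 * μv + 2 * π * lamR * r * μv
      * ∫ x in (0 : ℝ)..π, Real.exp (-(r * (2 * μv)) * Real.sin x)) := by
  rw [pdfV2V, survivalV2V, struveL_neg_one_sub_besselI_one, besselI_zero_sub_struveL_zero,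
    show 2 * r * μv = r * (2 * μv) by ring]
  have hπ := Real.pi_ne_zero
  have e (K : ℝ) : -2 * π * lamR * r + π ^ 2 * lamR * r * (K / π) - r * (2 * μv)
      = -(2 * μv * r) - lamR * (π * (2 * r - r * K)) := by
    field_simp
    ring
  rw [e]
  field_simp
  ring

theorem integral_exp_sin_nonneg (z : ℝ) :
    0 ≤ ∫ x in (0 : ℝ)..π, Real.exp (z * Real.sin x) :=
  intervalIntegral.integral_nonneg Real.pi_pos.le fun _ _ => (Real.exp_pos _).le

theorem pdfV2V_nonneg (hlamR : 0 ≤ lamR) (hμv : 0 ≤ μv) {r : ℝ} (hr : 0 ≤ r) :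
    0 ≤ pdfV2V lamR μv r := by
  rw [pdfV2V_eq]
  have := integral_exp_sin_nonneg (-(r * (2 * μv)))
  have := Real.pi_pos
  have : 0 ≤ survivalV2V lamR μv r := (Real.exp_pos _).le
  positivity

theorem hasDerivAt_survivalV2V (hμv : μv ≠ 0) (r : ℝ) :
    HasDerivAt (survivalV2V lamR μv) (-pdfV2V lamR μv r) r := by
  have h1 := (hasDerivAt_mul_integral_sin_mul_exp (r * (2 * μv))).comp r
    ((hasDerivAt_id' r).mul_const (2 * μv))
  have h2 := (h1.div_const (2 * μv))
  have h3 : (fun r => ((fun z => z * ∫ x in (0 : ℝ)..π, Real.sin x * Real.exp (-z * Real.sin x))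
        ∘ fun y => y * (2 * μv)) r / (2 * μv))
      = fun r => r * ∫ x in (0 : ℝ)..π, Real.sin x * Real.exp (-(r * (2 * μv)) * Real.sin x) := by
    ext r
    simp only [Function.comp_apply]
    field_simp
  -- `r K(2 μv r) = W(2 μv r) / (2 μv)` for `W(z) = z K(z)`, whose derivative is known
  rw [h3] at h2
  have h4 := (((hasDerivAt_id' r).const_mul (2 * μv)).neg.sub
    (((((hasDerivAt_id' r).const_mul 2).sub h2).const_mul π).const_mul lamR)).exp
  refine h4.congr_deriv ?_
  rw [pdfV2V_eq, survivalV2V]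
  simp only [Pi.neg_apply, Pi.sub_apply]
  field_simp
  ring

theorem survivalV2V_zero : survivalV2V lamR μv 0 = 1 := by
  simp [survivalV2V]

theorem integral_one_sub_exp_sqrt_nonneg {r : ℝ} (hr : 0 ≤ r) (hμv : 0 ≤ μv) :
    0 ≤ 2 * r - r * ∫ x in (0 : ℝ)..π, Real.sin x * Real.exp (-(r * (2 * μv)) * Real.sin x) := by
  rw [← integral_one_sub_exp_sqrt hr]
  refine intervalIntegral.integral_nonneg (by linarith) fun y _ => ?_
  rw [sub_nonneg, Real.exp_le_one_iff, neg_nonpos]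
  positivity

theorem tendsto_survivalV2V (hlamR : 0 ≤ lamR) (hμv : 0 < μv) :
    Tendsto (survivalV2V lamR μv) atTop (𝓝 0) := by
  have h : Tendsto (fun r : ℝ => Real.exp (-(2 * μv * r))) atTop (𝓝 0) :=
    Real.tendsto_exp_neg_atTop_nhds_zero.comp
      (Filter.tendsto_id.const_mul_atTop (by positivity : 0 < 2 * μv))
  refine squeeze_zero' (Filter.Eventually.of_forall fun r => (Real.exp_pos _).le) ?_ h
  filter_upwards [Filter.eventually_ge_atTop 0] with r hr
  refine Real.exp_le_exp.2 (sub_le_self _ ?_)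
  exact mul_nonneg hlamR (mul_nonneg Real.pi_pos.le (integral_one_sub_exp_sqrt_nonneg hr hμv.le))

theorem integrableOn_pdfV2V (hlamR : 0 ≤ lamR) (hμv : 0 < μv) {a : ℝ} (ha : 0 ≤ a) :
    IntegrableOn (pdfV2V lamR μv) (Ioi a) := by
  have := integrableOn_Ioi_deriv_of_nonpos' (a := a)
    (fun r _ => hasDerivAt_survivalV2V (lamR := lamR) hμv.ne' r)
    (fun r hr => neg_nonpos.2 (pdfV2V_nonneg hlamR hμv.le (ha.trans (le_of_lt hr))))
    (tendsto_survivalV2V hlamR hμv)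
  simpa using this.neg

theorem lintegral_pdfV2V (hlamR : 0 ≤ lamR) (hμv : 0 < μv) {a : ℝ} (ha : 0 ≤ a) :
    ∫⁻ r in Ioi a, ENNReal.ofReal (pdfV2V lamR μv r)
      = ENNReal.ofReal (survivalV2V lamR μv a) := by
  have := integral_Ioi_of_hasDerivAt_of_nonpos' (a := a)
    (fun r _ => hasDerivAt_survivalV2V (lamR := lamR) hμv.ne' r)
    (fun r hr => neg_nonpos.2 (pdfV2V_nonneg hlamR hμv.le (ha.trans (le_of_lt hr))))
    (tendsto_survivalV2V hlamR hμv)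
  rw [integral_neg, zero_sub, neg_inj] at this
  rw [← this, ofReal_integral_eq_lintegral_ofReal (integrableOn_pdfV2V hlamR hμv ha)]
  exact (ae_restrict_iff' measurableSet_Ioi).2 (Filter.Eventually.of_forall fun r hr =>
    pdfV2V_nonneg hlamR hμv.le (ha.trans (le_of_lt hr)))

/-- The exponent in the generating functional of the line process, for the probability that a line
at distance `|y|` carries no vehicle within distance `r` of the origin. -/
theorem integral_one_sub_exp_sqrt_lines (hlamR : 0 ≤ lamR) {r : ℝ} (hr : 0 ≤ r) (c : ℝ) :
    ∫ p : ℝ × ℝ, (1 - Real.exp (-(c * √(r ^ 2 - p.2 ^ 2)))) ∂(ENNReal.ofReal lamR •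
        (volume : Measure (ℝ × ℝ)).restrict (Ico 0 π ×ˢ univ))
      = lamR * (π * (2 * r
        - r * ∫ x in (0 : ℝ)..π, Real.sin x * Real.exp (-(r * c) * Real.sin x))) := by
  rw [integral_smul_measure, ENNReal.toReal_ofReal hlamR, smul_eq_mul,
    Measure.volume_eq_prod, ← Measure.prod_restrict,
    integral_fun_snd (fun y => 1 - Real.exp (-(c * √(r ^ 2 - y ^ 2)))),
    ← integral_one_sub_exp_sqrt hr, intervalIntegral.integral_of_le (by linarith),
    Measure.restrict_univ, setIntegral_eq_integral_of_forall_compl_eq_zero]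
  · simp [Measure.real, Real.pi_pos.le]
  · intro y hy
    have : r ^ 2 - y ^ 2 ≤ 0 := by
      rw [mem_Ioc, not_and_or, not_lt, not_le] at hy
      rcases hy with hy | hy <;> nlinarith
    rw [Real.sqrt_eq_zero_of_nonpos this]
    simp

end Survival

/-! ### The distance to the nearest vehicle -/

section Vehicles

theorem norm_linePoint (p : ℝ × ℝ) (t : ℝ) : ‖linePoint p t‖ = √(p.2 ^ 2 + t ^ 2) := by
  rw [EuclideanSpace.norm_eq]
  simp only [linePoint, Fin.sum_univ_two, Real.norm_eq_abs, sq_abs]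
  congr 1
  simp only [Matrix.cons_val_zero, Matrix.cons_val_one]
  linear_combination (p.2 ^ 2 + t ^ 2) * Real.sin_sq_add_cos_sq p.1

theorem le_norm_linePoint_iff {r : ℝ} (hr : 0 < r) (p : ℝ × ℝ) (t : ℝ) :
    r ≤ ‖linePoint p t‖ ↔ √(r ^ 2 - p.2 ^ 2) ≤ |t| := by
  rw [norm_linePoint, Real.le_sqrt' hr, Real.sqrt_le_iff, sq_abs]
  constructor
  · exact fun h => ⟨abs_nonneg t, by linarith⟩
  · exact fun h => by linarith [h.2]

/-- On each road it suffices to know the abscissa nearest to the foot of the perpendicular. The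
first conjunct excludes the case of no vehicles, in which the V2V distance is zero by
convention. -/
theorem le_distV2V_iff {Ω : Type*} (L : ℕ → Ω → ℝ × ℝ) (θ₀ : Ω → ℝ)
    (V : Option ℕ → Ω → Set ℝ) (ω : Ω) {r : ℝ} (hr : 0 < r) :
    r ≤ distV2V L θ₀ V ω ↔ (∃ i, Metric.infEDist 0 (V i ω) < ⊤) ∧
      ∀ i, ENNReal.ofReal √(r ^ 2 - (roadCoord L θ₀ i ω).2 ^ 2)
        ≤ Metric.infEDist 0 (V i ω) := by
  have hne : (vehicles L θ₀ V ω).Nonempty ↔ ∃ i, Metric.infEDist 0 (V i ω) < ⊤ := by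
    simp [lt_top_iff_ne_top, vehicles, nonempty_iff_ne_empty]
  by_cases h : (vehicles L θ₀ V ω).Nonempty
  · rw [distV2V, Metric.le_infDist h, ← hne, and_iff_right h]
    simp only [Metric.le_infEDist, vehicles, mem_iUnion, mem_image,
      dist_zero_left, forall_exists_index, and_imp]
    constructor
    · intro H i t ht
      rw [edist_dist, dist_zero_left, Real.norm_eq_abs]
      exact ENNReal.ofReal_le_ofReal ((le_norm_linePoint_iff hr _ _).1 (H i t ht rfl))
    · rintro H _ i t ht rfl
      have := H i t ht
      rw [edist_dist, dist_zero_left, Real.norm_eq_abs,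
        ENNReal.ofReal_le_ofReal_iff (abs_nonneg t)] at this
      exact (le_norm_linePoint_iff hr _ _).2 this
  · rw [← hne]
    simp only [h, false_and, iff_false, not_le]
    rw [distV2V, not_nonempty_iff_eq_empty.1 h, Metric.infDist_empty]
    exact hr

theorem distV2V_nonneg {Ω : Type*} (L : ℕ → Ω → ℝ × ℝ) (θ₀ : Ω → ℝ)
    (V : Option ℕ → Ω → Set ℝ) (ω : Ω) : 0 ≤ distV2V L θ₀ V ω :=
  Metric.infDist_nonneg

theorem measurable_distV2V {Ω : Type*} [MeasurableSpace Ω] {L : ℕ → Ω → ℝ × ℝ} (θ₀ : Ω → ℝ)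
    {V : Option ℕ → Ω → Set ℝ} (hL : ∀ n, Measurable (L n))
    (hV : ∀ i, Measurable fun ω => Metric.infEDist 0 (V i ω)) :
    Measurable (distV2V L θ₀ V) := by
  refine measurable_of_Ici fun r => ?_
  rcases le_or_gt r 0 with hr | hr
  · convert MeasurableSet.univ
    exact eq_univ_of_forall fun ω => hr.trans (distV2V_nonneg L θ₀ V ω)
  · have e : distV2V L θ₀ V ⁻¹' Ici r = (⋃ i, {ω | Metric.infEDist 0 (V i ω) < ⊤}) ∩
        ⋂ i, {ω | ENNReal.ofReal √(r ^ 2 - (roadCoord L θ₀ i ω).2 ^ 2)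
          ≤ Metric.infEDist 0 (V i ω)} := by
      ext ω
      simpa using le_distV2V_iff L θ₀ V ω hr
    have hroad : ∀ i, Measurable fun ω => (roadCoord L θ₀ i ω).2
      | none => measurable_const
      | some n => (hL n).snd
    rw [e]
    refine (MeasurableSet.iUnion fun i => measurableSet_lt (hV i) measurable_const).inter
      (MeasurableSet.iInter fun i => measurableSet_le ?_ (hV i))
    have := hroad i
    fun_prop

variable {Ω : Type*} [MeasurableSpace Ω] {P : Measure Ω}
  {lamR μv : ℝ} {L : ℕ → Ω → ℝ × ℝ} {V : Option ℕ → Ω → Set ℝ}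

theorem IsVehicleProcess.measurable_infEDist (hV : IsVehicleProcess P L V μv) (i : Option ℕ) :
    Measurable fun ω => Metric.infEDist 0 (V i ω) :=
  (measurable_infEDist_pointSigma (V i) 0).mono (pointSigma_le (hV.poisson i).measurable_count)
    le_rfl

theorem IsVehicleProcess.measure_le_infEDist (hV : IsVehicleProcess P L V μv) (hμv : 0 ≤ μv)
    (i : Option ℕ) {s : ℝ} (hs : 0 ≤ s) :
    P {ω | ENNReal.ofReal s ≤ Metric.infEDist 0 (V i ω)}
      = ENNReal.ofReal (Real.exp (-(2 * μv * s))) := by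
  have hν : (ENNReal.ofReal μv • (volume : Measure ℝ)) (Metric.eball 0 (ENNReal.ofReal s))
      = ENNReal.ofReal (2 * μv * s) := by
    rw [Metric.eball_ofReal, Measure.smul_apply, Real.volume_ball, smul_eq_mul,
      ← ENNReal.ofReal_mul hμv]
    congr 1
    ring
  rw [(hV.poisson i).measure_le_infEDist 0 _ (by rw [hν]; exact ENNReal.ofReal_ne_top),
    Measure.real, hν, ENNReal.toReal_ofReal (by positivity)]

theorem IsVehicleProcess.iIndepFun_infEDist (hV : IsVehicleProcess P L V μv) :
    iIndepFun (fun i ω => Metric.infEDist 0 (V i ω)) P :=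
  (iIndepFun_iff_iIndep _ _ _).2 (iIndep_of_iIndep_of_le hV.indep_roads fun i =>
    (measurable_infEDist_pointSigma (V i) 0).comap_le)

theorem IsVehicleProcess.indepFun (hV : IsVehicleProcess P L V μv) :
    IndepFun (fun ω n => L n ω) (fun ω i => Metric.infEDist 0 (V i ω)) P := by
  rw [IndepFun_iff_Indep]
  refine indep_of_indep_of_le_left (indep_of_indep_of_le_right hV.indep_lines ?_) ?_
  · refine comap_pi_le fun i => ?_
    exact (measurable_infEDist_pointSigma (V i) 0).mono
      (le_iSup (fun i => pointSigma (V i)) i) le_rfl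
  · refine comap_pi_le fun n => ?_
    exact (comap_measurable (L n)).mono
      (le_iSup (fun n => MeasurableSpace.comap (L n) inferInstance) n) le_rfl

variable [IsProbabilityMeasure P]

/-- Given the lines, the roads are empty near the origin independently of each other. -/
theorem IsVehicleProcess.measureReal_finite_void (hV : IsVehicleProcess P L V μv)
    (hL : ∀ n, Measurable (L n)) (hμv : 0 ≤ μv) {r : ℝ} (hr : 0 ≤ r) (N : ℕ) :
    P.real {ω | ENNReal.ofReal r ≤ Metric.infEDist 0 (V none ω) ∧ ∀ n < N,
        ENNReal.ofReal √(r ^ 2 - (L n ω).2 ^ 2) ≤ Metric.infEDist 0 (V (some n) ω)}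
      = Real.exp (-(2 * μv * r)) * ∫ ω, ∏ n ∈ Finset.range N,
          Real.exp (-(2 * μv * √(r ^ 2 - (L n ω).2 ^ 2))) ∂P := by
  let S : Set ((ℕ → ℝ × ℝ) × (Option ℕ → ENNReal)) := {q | ENNReal.ofReal r ≤ q.2 none ∧ ∀ n < N,
    ENNReal.ofReal √(r ^ 2 - (q.1 n).2 ^ 2) ≤ q.2 (some n)}
  have hS : MeasurableSet S := by
    have : S = {q | ENNReal.ofReal r ≤ q.2 none} ∩ ⋂ n, ⋂ (_ : n < N),
        {q | ENNReal.ofReal √(r ^ 2 - (q.1 n).2 ^ 2) ≤ q.2 (some n)} := by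
      ext q
      simp [S]
    rw [this]
    refine (measurableSet_le measurable_const (by fun_prop)).inter
      (.iInter fun n => .iInter fun _ => measurableSet_le (by fun_prop) (by fun_prop))
  have h := measureReal_mem_eq_integral (measurable_pi_lambda _ hL)
    (measurable_pi_lambda _ hV.measurable_infEDist) hV.indepFun hS
  refine h.trans ?_
  rw [← integral_const_mul]
  refine integral_congr_ae (Filter.Eventually.of_forall fun ω => ?_)
  let σ : Option ℕ → ℝ := fun i => i.elim r fun n => √(r ^ 2 - (L n ω).2 ^ 2)
  have hσ : ∀ i, 0 ≤ σ i
    | none => hr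
    | some n => Real.sqrt_nonneg _
  have e : {ω' | ((fun n => L n ω), fun i => Metric.infEDist 0 (V i ω')) ∈ S}
      = ⋂ i ∈ Finset.insertNone (Finset.range N),
        (fun ω' => Metric.infEDist 0 (V i ω')) ⁻¹' Ici (ENNReal.ofReal (σ i)) := by
    ext ω'
    simp [S, σ, Option.forall]
  simp only
  rw [e, Measure.real, hV.iIndepFun_infEDist.meas_biInter fun i _ => ⟨_, measurableSet_Ici, rfl⟩,
    ENNReal.toReal_prod, Finset.prod_insertNone]
  have hi (i : Option ℕ) : (P ((fun ω' => Metric.infEDist 0 (V i ω')) ⁻¹'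
      Ici (ENNReal.ofReal (σ i)))).toReal = Real.exp (-(2 * μv * σ i)) := by
    refine (congrArg ENNReal.toReal (hV.measure_le_infEDist hμv i (hσ i))).trans ?_
    rw [ENNReal.toReal_ofReal (Real.exp_pos _).le]
  simp only [hi]
  rfl

theorem measureReal_le_distV2V (hLP : IsPoissonLineProcess P L lamR)
    (hV : IsVehicleProcess P L V μv) (hlamR : 0 ≤ lamR) (hμv : 0 < μv) (θ₀ : Ω → ℝ) {r : ℝ}
    (hr : 0 < r) : P.real {ω | r ≤ distV2V L θ₀ V ω} = survivalV2V lamR μv r := by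
  let E (N : ℕ) : Set Ω := {ω | ENNReal.ofReal r ≤ Metric.infEDist 0 (V none ω) ∧ ∀ n < N,
    ENNReal.ofReal √(r ^ 2 - (L n ω).2 ^ 2) ≤ Metric.infEDist 0 (V (some n) ω)}
  have hEm (N : ℕ) : MeasurableSet (E N) := by
    have : E N = {ω | ENNReal.ofReal r ≤ Metric.infEDist 0 (V none ω)} ∩ ⋂ n, ⋂ (_ : n < N),
        {ω | ENNReal.ofReal √(r ^ 2 - (L n ω).2 ^ 2) ≤ Metric.infEDist 0 (V (some n) ω)} := by
      ext ω
      simp [E]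
    rw [this]
    refine (measurableSet_le measurable_const (hV.measurable_infEDist none)).inter
      (.iInter fun n => .iInter fun _ => measurableSet_le ?_ (hV.measurable_infEDist _))
    have := hLP.measurable n
    fun_prop
  have hanti : Antitone E := fun M N hMN ω hω => ⟨hω.1, fun n hn => hω.2 n (hn.trans_le hMN)⟩
  have hlim1 : Tendsto (fun N => P.real (E N)) atTop (𝓝 (P.real (⋂ N, E N))) :=
    (ENNReal.tendsto_toReal (measure_ne_top _ _)).comp
      (tendsto_measure_iInter_atTop (fun N => (hEm N).nullMeasurableSet) hanti
        ⟨0, measure_ne_top _ _⟩)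
  have hlim2 : Tendsto (fun N => P.real (E N)) atTop (𝓝 (survivalV2V lamR μv r)) := by
    simp only [E, hV.measureReal_finite_void hLP.measurable hμv.le hr.le]
    rw [survivalV2V, sub_eq_add_neg, Real.exp_add]
    refine Tendsto.const_mul _ ?_
    -- all angles are allowed in `A`: the intensity is carried by those in `[0, π)`
    have h := hLP.poisson.tendsto_integral_prod hLP.measurable hLP.injective
      (A := univ ×ˢ Icc (-r) r) (MeasurableSet.univ.prod measurableSet_Icc) ?_
      (g := fun p => Real.exp (-(2 * μv * √(r ^ 2 - p.2 ^ 2)))) (by fun_prop) ?_ ?_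
    · rwa [integral_one_sub_exp_sqrt_lines hlamR hr.le] at h
    · rw [Measure.smul_apply, Measure.restrict_apply (MeasurableSet.univ.prod measurableSet_Icc),
        prod_inter_prod, univ_inter, inter_univ, Measure.volume_eq_prod, Measure.prod_prod,
        Real.volume_Ico, Real.volume_Icc, smul_eq_mul]
      finiteness
    · exact fun p => ⟨(Real.exp_pos _).le, Real.exp_le_one_iff.2 (by
        rw [neg_nonpos]; positivity)⟩
    · intro p hp
      have : r ^ 2 - p.2 ^ 2 ≤ 0 := by
        simp only [mem_prod, mem_univ, true_and, mem_Icc, not_and_or, not_le] at hp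
        rcases hp with hp | hp <;> nlinarith
      rw [Real.sqrt_eq_zero_of_nonpos this]
      simp
  rw [← tendsto_nhds_unique hlim1 hlim2]
  refine measureReal_congr ?_
  have hfin : ∀ᵐ ω ∂P, Metric.infEDist 0 (V none ω) < ⊤ := by
    refine ae_lt_top_of_tendsto (fun s hs => (hV.measure_le_infEDist hμv.le none hs.le).le) ?_
    exact Real.tendsto_exp_neg_atTop_nhds_zero.comp
      (Filter.tendsto_id.const_mul_atTop (by positivity : 0 < 2 * μv))
  filter_upwards [hfin] with ω hω
  apply propext
  change r ≤ distV2V L θ₀ V ω ↔ ω ∈ ⋂ N, E N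
  rw [le_distV2V_iff L θ₀ V ω hr, and_iff_right ⟨none, hω⟩, Option.forall]
  simp only [roadCoord, mem_iInter, E, mem_ofPred_eq]
  rw [zero_pow two_ne_zero, sub_zero, Real.sqrt_sq hr.le]
  exact ⟨fun h N => ⟨h.1, fun n _ => h.2 n⟩,
    fun h => ⟨(h 0).1, fun n => (h (n + 1)).2 n n.lt_succ_self⟩⟩

/-- The V2V distance has density `pdfV2V`: both measures have the same tails. -/
theorem map_distV2V (hLP : IsPoissonLineProcess P L lamR) (hV : IsVehicleProcess P L V μv)
    (hlamR : 0 ≤ lamR) (hμv : 0 < μv) (θ₀ : Ω → ℝ) :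
    P.map (distV2V L θ₀ V) =
      (volume.restrict (Ioi (0 : ℝ))).withDensity (fun r => ENNReal.ofReal (pdfV2V lamR μv r)) := by
  have hm : Measurable (distV2V L θ₀ V) :=
    measurable_distV2V θ₀ hLP.measurable hV.measurable_infEDist
  have : IsProbabilityMeasure (P.map (distV2V L θ₀ V)) :=
    Measure.isProbabilityMeasure_map hm.aemeasurable
  refine Measure.ext_of_Ici _ _ fun a => ?_
  rw [Measure.map_apply hm measurableSet_Ici, withDensity_apply _ measurableSet_Ici,
    Measure.restrict_restrict measurableSet_Ici]
  rcases le_or_gt a 0 with ha | ha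
  · have e1 : distV2V L θ₀ V ⁻¹' Ici a = univ :=
      eq_univ_of_forall fun ω => ha.trans (distV2V_nonneg L θ₀ V ω)
    have e2 : Ici a ∩ Ioi 0 = Ioi 0 :=
      inter_eq_right.2 fun x hx => ha.trans (le_of_lt hx)
    rw [e1, e2, measure_univ, lintegral_pdfV2V hlamR hμv le_rfl, survivalV2V_zero,
      ENNReal.ofReal_one]
  · have e2 : Ici a ∩ Ioi 0 = Ici a := inter_eq_left.2 fun x hx => ha.trans_le hx
    rw [e2, setLIntegral_congr Ioi_ae_eq_Ici.symm, lintegral_pdfV2V hlamR hμv ha.le,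
      ← measureReal_le_distV2V hLP hV hlamR hμv θ₀ ha, ofReal_measureReal]
    rfl

end Vehicles

/-! ### The distance to the nearest base station -/

section BaseStations

variable {Ω : Type*} {m mΩ : MeasurableSpace Ω} {P : Measure Ω} [IsProbabilityMeasure P]
  {lamb : ℝ} {Φb : Ω → Set Plane} {T : Ω → Plane}

/-- Given the location `T` and the radius `σ`, which are independent of the base stations, the disc
of radius `σ` about `T` contains no base station with probability `exp (-π lamb σ ^ 2)`. -/
theorem measureReal_le_infEDist_of_indep
    (hΦb : IsPoissonProcess P Φb (ENNReal.ofReal lamb • (volume : Measure Plane)))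
    (hlamb : 0 ≤ lamb) (hm : m ≤ mΩ) (hindep : Indep m (pointSigma Φb) P)
    (hT : Measurable[m] T) {σ : Ω → ℝ} (hσ : Measurable[m] σ) (hσ0 : ∀ ω, 0 ≤ σ ω) :
    P.real {ω | ENNReal.ofReal (σ ω) ≤ Metric.infEDist (T ω) (Φb ω)}
      = ∫ ω, Real.exp (-π * lamb * σ ω ^ 2) ∂P := by
  let S : Set ((Plane × ℝ) × Ω) := {q | ENNReal.ofReal q.1.2 ≤ Metric.infEDist q.1.1 (Φb q.2)}
  have hS : MeasurableSet[@Prod.instMeasurableSpace _ _ _ (pointSigma Φb)] S := by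
    have h1 : @Measurable _ _ (@Prod.instMeasurableSpace _ _ _ (pointSigma Φb)) _
        (Function.uncurry fun (t : Plane) ω => Metric.infEDist t (Φb ω)) :=
      measurable_uncurry_of_continuous_of_measurable (m := pointSigma Φb)
        (fun ω => Metric.continuous_infEDist) (measurable_infEDist_pointSigma Φb)
    let _ := pointSigma Φb
    refine measurableSet_le (by fun_prop) ?_
    exact h1.comp ((measurable_fst.comp measurable_fst).prodMk measurable_snd)
  have hX : Measurable[m] fun ω => (T ω, σ ω) := hT.prodMk hσ
  have hXY : @IndepFun _ _ _ mΩ _ (pointSigma Φb) (fun ω => (T ω, σ ω)) id P := by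
    rw [@IndepFun_iff_Indep, MeasurableSpace.comap_id]
    exact indep_of_indep_of_le_left hindep hX.comap_le
  have h := measureReal_mem_eq_integral (mF := pointSigma Φb) (hX.mono hm le_rfl)
    (measurable_id'' (pointSigma_le hΦb.measurable_count)) hXY hS
  refine h.trans (integral_congr_ae (Filter.Eventually.of_forall fun ω => ?_))
  have hν : (ENNReal.ofReal lamb • (volume : Measure Plane))
      (Metric.eball (T ω) (ENNReal.ofReal (σ ω))) = ENNReal.ofReal (π * lamb * σ ω ^ 2) := by
    rw [Metric.eball_ofReal, Measure.smul_apply, EuclideanSpace.volume_ball_fin_two, smul_eq_mul,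
      ← ENNReal.ofReal_pow (hσ0 ω), ← ENNReal.ofReal_mul (by positivity),
      ← ENNReal.ofReal_mul hlamb]
    congr 1
    ring
  have h2 := hΦb.measure_le_infEDist (T ω) (ENNReal.ofReal (σ ω))
    (by rw [hν]; exact ENNReal.ofReal_ne_top)
  refine (congrArg ENNReal.toReal h2).trans ?_
  have hπ := Real.pi_pos
  rw [ENNReal.toReal_ofReal (Real.exp_pos _).le, Measure.real, hν,
    ENNReal.toReal_ofReal (by positivity)]
  congr 1
  ring

/-- Almost surely there are base stations, and none of them is at `T`. -/
theorem ae_infEDist_pos_lt_top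
    (hΦb : IsPoissonProcess P Φb (ENNReal.ofReal lamb • (volume : Measure Plane)))
    (hlamb : 0 < lamb) (hm : m ≤ mΩ) (hindep : Indep m (pointSigma Φb) P)
    (hT : Measurable[m] T) :
    ∀ᵐ ω ∂P, 0 < Metric.infEDist (T ω) (Φb ω) ∧ Metric.infEDist (T ω) (Φb ω) < ⊤ := by
  have hπ := Real.pi_pos
  have hconst {s : ℝ} (hs : 0 ≤ s) :
      P.real {ω | ENNReal.ofReal s ≤ Metric.infEDist (T ω) (Φb ω)}
        = Real.exp (-π * lamb * s ^ 2) := by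
    rw [measureReal_le_infEDist_of_indep hΦb hlamb.le hm hindep hT
      (@measurable_const _ _ _ m s) fun _ => hs]
    simp
  have h1 : ∀ᵐ ω ∂P, Metric.infEDist (T ω) (Φb ω) < ⊤ := by
    refine ae_lt_top_of_tendsto (u := fun s => Real.exp (-π * lamb * s ^ 2)) (fun s hs => ?_) ?_
    · rw [← hconst hs.le, ofReal_measureReal]
    · refine Real.tendsto_exp_atBot.comp ?_
      exact (Filter.tendsto_pow_atTop two_ne_zero).const_mul_atTop_of_neg (by nlinarith)
  have h2 : ∀ᵐ ω ∂P, 0 < Metric.infEDist (T ω) (Φb ω) := by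
    have hpos : P.real {ω | 0 < Metric.infEDist (T ω) (Φb ω)} = 1 := by
      refine le_antisymm measureReal_le_one ?_
      have hl : Tendsto (fun s : ℝ => Real.exp (-π * lamb * s ^ 2)) (𝓝[>] 0) (𝓝 1) := by
        have : ContinuousAt (fun s : ℝ => Real.exp (-π * lamb * s ^ 2)) 0 := by fun_prop
        have h := this.tendsto
        simp only [ne_eq, OfNat.ofNat_ne_zero, not_false_eq_true, zero_pow, mul_zero,
          Real.exp_zero] at h
        exact h.mono_left nhdsWithin_le_nhds
      refine le_of_tendsto hl ?_
      filter_upwards [self_mem_nhdsWithin] with s hs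
      rw [← hconst (le_of_lt hs)]
      exact measureReal_mono fun ω hω => (ENNReal.ofReal_pos.2 hs).trans_le hω
    have hmeas : MeasurableSet {ω | 0 < Metric.infEDist (T ω) (Φb ω)} := by
      have h3 : Measurable (Function.uncurry fun (t : Plane) ω => Metric.infEDist t (Φb ω)) :=
        measurable_uncurry_of_continuous_of_measurable
          (fun ω => Metric.continuous_infEDist) fun t =>
          (measurable_infEDist_pointSigma Φb t).mono (pointSigma_le hΦb.measurable_count) le_rfl
      exact measurableSet_lt measurable_const
        (h3.comp ((hT.mono hm le_rfl).prodMk measurable_id))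
    have h4 : P {ω | 0 < Metric.infEDist (T ω) (Φb ω)} = 1 := by
      rw [← ofReal_measureReal (μ := P), hpos, ENNReal.ofReal_one]
    exact (prob_compl_eq_zero_iff hmeas).2 h4
  exact h2.and h1

end BaseStations

/-! ### The association probability -/

/-- The V2V link is the stronger one exactly when there is no base station within the distance
`(ρ ^ αv / B) ^ (1 / αb)`. -/
theorem rpow_neg_le_mul_rpow_neg_iff {B αv αb ρ b : ℝ} (hB : 0 < B) (hαb : 0 < αb) (hρ : 0 < ρ)
    (hb : 0 < b) : b ^ (-αb) ≤ B * ρ ^ (-αv) ↔ ρ ^ (αv / αb) / B ^ (1 / αb) ≤ b := by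
  have hs : (ρ ^ (αv / αb) / B ^ (1 / αb)) ^ αb = ρ ^ αv / B := by
    rw [Real.div_rpow (Real.rpow_nonneg hρ.le _) (Real.rpow_nonneg hB.le _), ← Real.rpow_mul hρ.le,
      ← Real.rpow_mul hB.le, div_mul_cancel₀ _ hαb.ne', div_mul_cancel₀ _ hαb.ne', Real.rpow_one]
  have e : B * ρ ^ (-αv) = (ρ ^ αv / B)⁻¹ := by
    rw [Real.rpow_neg hρ.le, inv_div, div_eq_mul_inv]
  have h1 : 0 < ρ ^ αv / B := div_pos (Real.rpow_pos_of_pos hρ _) hB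
  have h2 : 0 < b ^ αb := Real.rpow_pos_of_pos hb _
  rw [e, Real.rpow_neg hb.le, inv_le_inv₀ h2 h1, ← hs,
    Real.rpow_le_rpow_iff (by positivity) hb.le hαb]

/-- The V2V distance does not depend on the direction `θ₀` of the typical road, and so is measurable
with respect to the lines and the vehicles alone. -/
theorem measurable_distV2V_iSup {Ω : Type*} (L : ℕ → Ω → ℝ × ℝ) (θ₀ : Ω → ℝ)
    (V : Option ℕ → Ω → Set ℝ) :
    Measurable[(⨆ n, MeasurableSpace.comap (L n) inferInstance) ⊔ (⨆ i, pointSigma (V i))]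
      (distV2V L θ₀ V) := by
  refine @measurable_distV2V Ω (_) L θ₀ V (fun n => ?_) fun i => ?_
  · exact (comap_measurable (L n)).mono
      ((le_iSup (fun n => MeasurableSpace.comap (L n) inferInstance) n).trans le_sup_left) le_rfl
  · exact (measurable_infEDist_pointSigma (V i) 0).mono
      ((le_iSup (fun i => pointSigma (V i)) i).trans le_sup_right) le_rfl

/-- The association probability given the law of the V2V distance, here any nonnegative `R` that is
independent of the base stations jointly with `T`. -/
theorem measureReal_association {Ω : Type*} {m mΩ : MeasurableSpace Ω} {P : Measure Ω}
    [IsProbabilityMeasure P] {lamb B αv αb : ℝ} {Φb : Ω → Set Plane} {T : Ω → Plane} {R : Ω → ℝ}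
    (hΦb : IsPoissonProcess P Φb (ENNReal.ofReal lamb • (volume : Measure Plane)))
    (hlamb : 0 < lamb) (hB : 0 < B) (hαb : 0 < αb) (hm : m ≤ mΩ)
    (hindep : Indep m (pointSigma Φb) P) (hT : Measurable[m] T) (hR : Measurable[m] R)
    (hR0 : ∀ ω, 0 ≤ R ω) (hRpos : ∀ᵐ ω ∂P, 0 < R ω) :
    P.real {ω | B * R ω ^ (-αv) ≥ distV2B T Φb ω ^ (-αb)}
      = ∫ ω, Real.exp (-π * lamb * (R ω ^ (αv / αb) / B ^ (1 / αb)) ^ 2) ∂P := by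
  have hσm : Measurable fun ρ : ℝ => ρ ^ (αv / αb) / B ^ (1 / αb) := by fun_prop
  have hσR : Measurable[m] fun ω => R ω ^ (αv / αb) / B ^ (1 / αb) := hσm.comp hR
  rw [← measureReal_le_infEDist_of_indep hΦb hlamb.le hm hindep hT hσR
    fun ω => div_nonneg (Real.rpow_nonneg (hR0 ω) _) (Real.rpow_nonneg hB.le _)]
  refine measureReal_congr ?_
  filter_upwards [hRpos, ae_infEDist_pos_lt_top hΦb hlamb hm hindep hT] with ω h1 h2
  apply propext
  change distV2B T Φb ω ^ (-αb) ≤ B * R ω ^ (-αv) ↔ _ ≤ _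
  have hb : 0 < distV2B T Φb ω := ENNReal.toReal_pos h2.1.ne' h2.2.ne
  rw [rpow_neg_le_mul_rpow_neg_iff hB hαb h1 hb, ENNReal.ofReal_le_iff_le_toReal h2.2.ne]
  rfl

theorem mainTheorem4
    {Ω : Type*} [MeasurableSpace Ω] (P : Measure Ω) [IsProbabilityMeasure P]
    (lamR μv lamb B αv αb : ℝ)
    (hlamR : 0 < lamR) (hμv : 0 < μv) (hlamb : 0 < lamb)
    (hB : 0 < B) (hαv : 0 < αv) (hαb : 0 < αb)
    -- the roads, the direction of the typical road, and the vehicles on the roads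
    (L : ℕ → Ω → ℝ × ℝ) (θ₀ : Ω → ℝ) (V : Option ℕ → Ω → Set ℝ)
    (hL : IsPoissonLineProcess P L lamR)
    (hV : IsVehicleProcess P L V μv)
    -- the base stations, and the location of the transmitter
    (Φb : Ω → Set Plane) (T : Ω → Plane)
    (hΦb : IsPoissonProcess P Φb (ENNReal.ofReal lamb • (volume : Measure Plane)))
    (hT : Measurable T)
    (hindep : Indep
      ((⨆ n, MeasurableSpace.comap (L n) inferInstance) ⊔ (⨆ i, pointSigma (V i))
        ⊔ MeasurableSpace.comap T inferInstance)
      (pointSigma Φb) P) :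
    -- the closed form is the density of the V2V distance
    (∀ r : ℝ, 0 < r → 0 ≤ pdfV2V lamR μv r) ∧
    P.map (distV2V L θ₀ V) =
      (volume.restrict (Ioi (0 : ℝ))).withDensity (fun r => ENNReal.ofReal (pdfV2V lamR μv r)) ∧
    -- the probability of selecting the V2V link
    IntegrableOn (fun r : ℝ => pdfV2V lamR μv r *
      Real.exp (-Real.pi * lamb * (r ^ (αv / αb) / B ^ (1 / αb)) ^ 2)) (Ioi 0) ∧
    P.real {ω | B * distV2V L θ₀ V ω ^ (-αv) ≥ distV2B T Φb ω ^ (-αb)} =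
      ∫ r in Ioi (0 : ℝ), pdfV2V lamR μv r *
        Real.exp (-Real.pi * lamb * (r ^ (αv / αb) / B ^ (1 / αb)) ^ 2) := by
  have hπ := Real.pi_pos
  have hmap := map_distV2V hL hV hlamR.le hμv θ₀
  have hpdf := integrableOn_pdfV2V hlamR.le hμv le_rfl
  have hpdf0 : ∀ r : ℝ, 0 < r → 0 ≤ pdfV2V lamR μv r := fun r hr =>
    pdfV2V_nonneg hlamR.le hμv.le hr.le
  have hRm : Measurable (distV2V L θ₀ V) :=
    measurable_distV2V θ₀ hL.measurable hV.measurable_infEDist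
  refine ⟨hpdf0, hmap, ?_, ?_⟩
  · refine hpdf.mul_bdd (c := 1) (Measurable.aestronglyMeasurable (by fun_prop))
      (Filter.Eventually.of_forall fun r => ?_)
    rw [Real.norm_eq_abs, Real.abs_exp, Real.exp_le_one_iff]
    have : 0 ≤ π * lamb * (r ^ (αv / αb) / B ^ (1 / αb)) ^ 2 := by positivity
    linarith
  have hle : (⨆ n, MeasurableSpace.comap (L n) inferInstance) ⊔ (⨆ i, pointSigma (V i))
      ⊔ MeasurableSpace.comap T inferInstance ≤ ‹MeasurableSpace Ω› := sup_le (sup_le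
    (iSup_le fun n => (hL.measurable n).comap_le)
    (iSup_le fun i => pointSigma_le (hV.poisson i).measurable_count)) hT.comap_le
  have hRpos : ∀ᵐ ω ∂P, 0 < distV2V L θ₀ V ω := by
    have h0 : ∀ᵐ r ∂(P.map (distV2V L θ₀ V)), 0 < r := by
      rw [hmap]
      exact (withDensity_absolutelyContinuous _ _).ae_le (ae_restrict_mem measurableSet_Ioi)
    exact ae_of_ae_map hRm.aemeasurable h0
  rw [measureReal_association hΦb hlamb hB hαb hle hindep
    ((comap_measurable T).mono le_sup_right le_rfl)
    ((measurable_distV2V_iSup L θ₀ V).mono le_sup_left le_rfl)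
    (distV2V_nonneg L θ₀ V) hRpos]
  have h3 := integral_map (μ := P) hRm.aemeasurable
    (f := fun ρ => Real.exp (-π * lamb * (ρ ^ (αv / αb) / B ^ (1 / αb)) ^ 2))
    (Measurable.aestronglyMeasurable (by fun_prop))
  refine h3.symm.trans ?_
  rw [hmap, integral_withDensity_eq_integral_toReal_smul₀ hpdf.aemeasurable.ennreal_ofReal
    (Filter.Eventually.of_forall fun r => ENNReal.ofReal_lt_top)]
  refine setIntegral_congr_fun measurableSet_Ioi fun r hr => ?_
  simp only [ENNReal.toReal_ofReal (hpdf0 r hr), smul_eq_mul]
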